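/- Fix integers $n,\ell,t\ge 0$ and $k\ge 2$. Let $\mathcal G$ be the set of undirected simple graphs $G=(V_G,E_G,\mathrm{col}_G)$ with vertex set $V_G=[n]$ and vertex labels $\mathrm{col}_G:V_G\to\mathbb R^\ell$, and let $\mathcal G_1$ be the set of pairs $(G,v)$ with $G\in\mathcal G$ and $v\in V_G$. For a class $\mathcal F$ of functions on $\mathcal G_1$ (with possibly different codomains), $\rho_1(\mathcal F)$ is the equivalence relation on $\mathcal G_1$ given by $$\bigl((G,v),(H,w)\bigr)\in\rho_1(\mathcal F)\iff f(G,v)=f(H,w)\ \text{ for all } f\in\mathcal F .$$ *Weisfeiler-Leman.* For $r\ge 1$ and an $r$-tuple $\mathbf v\in V_G^r$, the atomic type $\mathrm{atp}_r(G,\mathbf v)\in\mathbb R^{2\binom r2+r\ell}$ consists of the $0/1$ values of $v_i=v_j$ for $i<j$, the $0/1$ values of $v_iv_j\in E_G$ for $i<j$, and the labels $\mathrm{col}_G(v_i)$ for $1\le i\le r$. Write $\mathbf v[u/i]$ for $\mathbf v$ with its $i$-th entry replaced by $u$. The (folklore) $r$-WL labels are $\mathrm{wl}_r^{(0)}(G,\mathbf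 v):=\mathrm{atp}_r(G,\mathbf v)$ and $$\mathrm{wl}_r^{(s+1)}(G,\mathbf v):=\Bigl(\mathrm{wl}_r^{(s)}(G,\mathbf v),\ \bigl\{\!\!\bigl\{\bigl(\mathrm{atp}_{r+1}(G,\mathbf v u),\mathrm{wl}_r^{(s)}(G,\mathbf v[u/1]),\dots,\mathrm{wl}_r^{(s)}(G,\mathbf v[u/r])\bigr)\ \big|\ u\in V_G\bigr\}\!\!\bigr\}\Bigr),$$ and $\mathrm{vwl}_r^{(s)}(G,v):=\mathrm{wl}_r^{(s)}(G,(v,\dots,v))$. *$k$-dimensional GINs.* Fix a continuous activation function $\sigma:\mathbb R\to\mathbb R$ that is not a polynomial. An MLP is a map $\mathbb R^p\to\mathbb R^q$ that alternates affine maps and coordinatewise applications of $\sigma$, with at least one hidden layer, arbitrary hidden widths, and an affine output layer. A $t$-layered $k$-GIN computes, for each $G\in\mathcal G$, tensors $F^{(0)},\dots,F^{(t)}$ indexed by $\mathbf v\in V_G^k$, where $F^{(0)}_{\mathbf v}:=\mathrm{atp}_k(G,\mathbf v)\in\mathbb R^{d_0}$, $d_0=2\binom k2+k\ell$, and for $1\le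 s\le t$ $$F^{(s)}_{\mathbf v}:=\mathrm{mlp}_0^{(s)}\Bigl(F^{(s-1)}_{\mathbf v},\ \sum_{u\in V_G}\mathrm{mlp}_1^{(s)}\bigl(F^{(s-1)}_{\mathbf v[u/1]}\bigr),\ \dots,\ \sum_{u\in V_G}\mathrm{mlp}_1^{(s)}\bigl(F^{(s-1)}_{\mathbf v[u/k]}\bigr)\Bigr)\in\mathbb R^{d_s},$$ with arbitrary dimensions $b_s,d_s$ and arbitrary MLPs $\mathrm{mlp}_1^{(s)}:\mathbb R^{d_{s-1}}\to\mathbb R^{b_s}$ and $\mathrm{mlp}_0^{(s)}:\mathbb R^{d_{s-1}+kb_s}\to\mathbb R^{d_s}$, which do not depend on $G$. Let $k\text{-}\mathsf{GIN}^{(t)}$ be the class of the vertex embeddings $(G,v)\mapsto F^{(t)}_{v,\dots,v}\in\mathbb R^{d_t}$ computed in this way. **Proposition.** For all $k\ge 2$ and $t\ge 0$, $$\rho_1\bigl(k\text{-}\mathsf{GIN}^{(t)}\bigr)=\rho_1\bigl(\mathrm{vwl}_{k-1}^{(t)}\bigr).$$ -/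

import Mathlib

noncomputable section

/-! ### Labelled graphs, atomic types and the folklore Weisfeiler-Leman algorithm -/

/-- An undirected simple graph on the vertex set `Fin n` with vertex labels in `ℝ^ℓ`. -/
structure LGraph (n ℓ : ℕ) where
  graph : SimpleGraph (Fin n)
  col : Fin n → Fin ℓ → ℝ

/-- The set `𝒢₁` of pairs `(G, v)` of a graph of size `n` and one of its vertices. -/
abbrev PointedGraph (n ℓ : ℕ) : Type := LGraph n ℓ × Fin n

/-- Pairs of positions `i < j` in a `k`-tuple; there are `k.choose 2` of them. -/
abbrev PosPair (k : ℕ) : Type := {p : Fin k × Fin k // p.1 < p.2}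

/-- Coordinates of the atomic type of a `k`-tuple: equality bits, adjacency bits, and the
labels of the entries; there are `2 * k.choose 2 + k * ℓ` of them. -/
abbrev AtpIndex (k ℓ : ℕ) : Type := PosPair k ⊕ PosPair k ⊕ (Fin k × Fin ℓ)

open Classical in
/-- The atomic type `atp_k(G, v)` of the `k`-tuple `v`, as a real vector. -/
def atp {n ℓ k : ℕ} (G : LGraph n ℓ) (v : Fin k → Fin n) : AtpIndex k ℓ → ℝ
  | Sum.inl p => if v p.1.1 = v p.1.2 then 1 else 0
  | Sum.inr (Sum.inl p) => if G.graph.Adj (v p.1.1) (v p.1.2) then 1 else 0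
  | Sum.inr (Sum.inr q) => G.col (v q.1) q.2

/-- The type of the labels that `k`-WL assigns to `k`-tuples after `t` rounds. -/
def WLLabel (k ℓ : ℕ) : ℕ → Type
  | 0 => AtpIndex k ℓ → ℝ
  | t + 1 => WLLabel k ℓ t × Multiset ((AtpIndex (k + 1) ℓ → ℝ) × (Fin k → WLLabel k ℓ t))

/-- The label of the `k`-tuple `v` after `t` rounds of (folklore) `k`-WL. In each round it is
paired with the multiset, over all vertices `u`, of the atomic type of the extended tuple `v u`
together with the labels of the `k` tuples `v[u/i]`. -/
def wl {n ℓ k : ℕ} : (t : ℕ) → LGraph n ℓ → (Fin k → Fin n) → WLLabel k ℓ t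
  | 0, G, v => atp G v
  | t + 1, G, v =>
    (wl t G v,
      (Finset.univ : Finset (Fin n)).val.map fun u =>
        (atp G (Fin.snoc v u : Fin (k + 1) → Fin n), fun i => wl t G (Function.update v i u)))

/-- The vertex labelling computed by `t` rounds of `k`-WL: the label of `(v, …, v)`. -/
def vwl {n ℓ : ℕ} (k t : ℕ) (x : PointedGraph n ℓ) : WLLabel k ℓ t :=
  wl t x.1 fun _ => x.2

/-! ### Separation power -/

/-- The equivalence relation `ρ₁(𝓕)` on pointed graphs defined by a class `𝓕` of functions
(whose codomains may vary): no function in the class separates the two arguments. -/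
def rhoOne {n ℓ : ℕ} (𝓕 : Set (Σ α : Type, PointedGraph n ℓ → α)) : Setoid (PointedGraph n ℓ) where
  r x y := ∀ f ∈ 𝓕, f.2 x = f.2 y
  iseqv :=
    { refl := fun _ _ _ => rfl
      symm := fun h f hf => (h f hf).symm
      trans := fun h₁ h₂ f hf => (h₁ f hf).trans (h₂ f hf) }

/-! ### Multilayer perceptrons and `k`-dimensional GINs -/

/-- `IsMLP σ f`: the map `f : ℝ^ι → ℝ^m` is a multilayer perceptron with activation function `σ`,
that is, an alternating composition of affine maps and coordinatewise applications of `σ`, with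
at least one hidden layer, any hidden widths, and an affine output layer. -/
inductive IsMLP (σ : ℝ → ℝ) {ι : Type} [Fintype ι] :
    {m : ℕ} → ((ι → ℝ) → Fin m → ℝ) → Prop
  | oneHidden {h m : ℕ} (A : Matrix (Fin h) ι ℝ) (a : Fin h → ℝ)
      (B : Matrix (Fin m) (Fin h) ℝ) (b : Fin m → ℝ) :
      IsMLP σ fun x => B.mulVec (fun i => σ ((A.mulVec x + a) i)) + b
  | addHidden {h m : ℕ} {g : (ι → ℝ) → Fin h → ℝ} (hg : IsMLP σ g)
      (B : Matrix (Fin m) (Fin h) ℝ) (b : Fin m → ℝ) :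
      IsMLP σ fun x => B.mulVec (fun i => σ (g x i)) + b

/-- One layer of a `k`-GIN: from tensors `F` with entries in `ℝ^ι`, it computes
`mlp₀ (F_v, ∑_u mlp₁ (F_{v[u/1]}), …, ∑_u mlp₁ (F_{v[u/k]}))` at the `k`-tuple `v`. -/
def ginLayer {n ℓ k b d : ℕ} {ι : Type} (mlp₁ : (ι → ℝ) → Fin b → ℝ)
    (mlp₀ : (ι ⊕ (Fin k × Fin b) → ℝ) → Fin d → ℝ)
    (F : LGraph n ℓ → (Fin k → Fin n) → ι → ℝ) :
    LGraph n ℓ → (Fin k → Fin n) → Fin d → ℝ :=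
  fun G v => mlp₀ (Sum.elim (F G v) fun p => ∑ u : Fin n, mlp₁ (F G (Function.update v p.1 u)) p.2)

/-- `IsGINTensor σ t F`: the assignment `F` of a tensor `F G`, indexed by `k`-tuples of vertices
and with entries in `ℝ^ι`, to each graph `G` is computed by a `k`-GIN with `t` layers. The initial
tensor consists of the atomic types, and each layer has its own perceptrons and dimensions. -/
inductive IsGINTensor (σ : ℝ → ℝ) {n ℓ k : ℕ} :
    ℕ → {ι : Type} → (LGraph n ℓ → (Fin k → Fin n) → ι → ℝ) → Prop
  | init : IsGINTensor σ 0 (fun (G : LGraph n ℓ) (v : Fin k → Fin n) => atp G v)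
  | layer {t b d : ℕ} {ι : Type} [Fintype ι] {F : LGraph n ℓ → (Fin k → Fin n) → ι → ℝ}
      (hF : IsGINTensor σ t F)
      {mlp₁ : (ι → ℝ) → Fin b → ℝ} (h₁ : IsMLP σ mlp₁)
      {mlp₀ : (ι ⊕ (Fin k × Fin b) → ℝ) → Fin d → ℝ} (h₀ : IsMLP σ mlp₀) :
      IsGINTensor σ (t + 1) (ginLayer mlp₁ mlp₀ F)

/-- The class `k-GIN^(t)` of vertex embeddings `(G, v) ↦ F_{v,…,v}` computed by the `k`-GINs with
`t` layers and activation function `σ`, on graphs of size `n` with labels in `ℝ^ℓ`. -/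
def kGIN (σ : ℝ → ℝ) (n ℓ k t : ℕ) : Set (Σ α : Type, PointedGraph n ℓ → α) :=
  {f | ∃ (ι : Type) (F : LGraph n ℓ → (Fin k → Fin n) → ι → ℝ),
    IsGINTensor σ t F ∧ f = ⟨ι → ℝ, fun x => F x.1 fun _ => x.2⟩}

end

/-! Both sides equal oblivious `k`-WL started at the constant tuple. A GIN layer aggregates over
each position separately, so induction on layers shows that no GIN separates obliviously equivalent
tuples (`IsGINTensor.eq_of_obliviousEquiv`). Conversely, on finitely many graphs MLPs interpolate
any function, so one layer can count the multiplicity of every feature and simulate one round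
(`exists_isGINTensor_obliviousEquiv`).

Oblivious `(r + 1)`-WL matches folklore `r`-WL round by round (`obliviousEquiv_iff`): changing
position `i` of `x` to `u` extends the `r`-tuple of the other entries by `u`, and the `r`-subtuples
of the result are, up to order, that tuple and its modifications `[u/j]`, exactly what a folklore
round inspects.

Interpolation rests on duality: if the ridge functions of `σ` fail to span, they satisfy a linear
relation; differencing it kills one direction at a time until an iterated difference of `σ` vanishes
for every step, and a continuous such `σ` is a polynomial. -/

open Filter Topology

/-! ### Interpolation by perceptrons -/

/-- A function with a vanishing iterated forward difference is a polynomial along every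
arithmetic progression with that step. -/
theorem exists_polynomial_eval_nat_of_fwdDiff_iter_eq_zero {f : ℝ → ℝ} {h : ℝ} {m : ℕ}
    (hf : ∀ x, (fwdDiff h)^[m] f x = 0) (y : ℝ) :
    ∃ p : Polynomial ℝ, ∀ n : ℕ, f (y + n * h) = p.eval (n : ℝ) := by
  have hzero : ∀ k, m ≤ k → (fwdDiff h)^[k] f y = 0 := by
    intro k hk
    obtain ⟨j, rfl⟩ := Nat.exists_eq_add_of_le' hk
    have h0 : (fwdDiff h)^[m] f = fun _ => 0 := funext hf
    rw [Function.iterate_add_apply, h0]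
    clear hk
    suffices H : (fwdDiff h)^[j] (fun _ : ℝ => (0 : ℝ)) = fun _ => 0 by rw [H]
    induction j with
    | zero => rfl
    | succ j ih => rw [Function.iterate_succ_apply, fwdDiff_const, ih]
  -- Newton's forward difference formula, truncated at `m`.
  refine ⟨∑ k ∈ Finset.range m,
    Polynomial.C ((fwdDiff h)^[k] f y / k.factorial) * descPochhammer ℝ k, fun n => ?_⟩
  have key := shift_eq_sum_fwdDiff_iter h f n y
  rw [nsmul_eq_mul] at key
  rw [key, Polynomial.eval_finsetSum]
  have hterm : ∀ k, n.choose k • (fwdDiff h)^[k] f y =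
      (Polynomial.C ((fwdDiff h)^[k] f y / k.factorial) * descPochhammer ℝ k).eval (n : ℝ) := by
    intro k
    rw [Polynomial.eval_mul, Polynomial.eval_C, descPochhammer_eval_eq_descFactorial,
      Nat.descFactorial_eq_factorial_mul_choose, nsmul_eq_mul]
    have : (k.factorial : ℝ) ≠ 0 := by positivity
    push_cast
    field_simp
  simp only [← hterm]
  rcases le_total (n + 1) m with hnm | hnm
  · refine Finset.sum_subset (Finset.range_mono hnm) fun k _ hk => ?_
    rw [Nat.choose_eq_zero_of_lt (by simpa using hk), zero_smul]
  · refine (Finset.sum_subset (Finset.range_mono hnm) fun k _ hk => ?_).symm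
    rw [hzero k (by simpa using hk), smul_zero]

/-- A continuous function all of whose `m`-th forward differences vanish is a polynomial on each
half-line. -/
theorem exists_polynomial_of_fwdDiff_iter_eq_zero_of_le {f : ℝ → ℝ} (hf : Continuous f) {m : ℕ}
    (hΔ : ∀ h x, (fwdDiff h)^[m] f x = 0) (y : ℝ) :
    ∃ p : Polynomial ℝ, ∀ x, y ≤ x → f x = p.eval x := by
  have hP : ∀ N : ℕ, ∃ p : Polynomial ℝ, ∀ n : ℕ,
      f (y + n * ((N : ℝ) + 1)⁻¹) = p.eval (y + n * ((N : ℝ) + 1)⁻¹) := by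
    intro N
    obtain ⟨p, hp⟩ :=
      exists_polynomial_eval_nat_of_fwdDiff_iter_eq_zero (hΔ ((N : ℝ) + 1)⁻¹) y
    refine ⟨p.comp (Polynomial.C ((N : ℝ) + 1) * (Polynomial.X - Polynomial.C y)), fun n => ?_⟩
    have : (N : ℝ) + 1 ≠ 0 := by positivity
    rw [hp n, Polynomial.eval_comp]
    congr 1
    simp
    field_simp
  choose P hP using hP
  -- Every grid of step `1 / (N + 1)` contains `y + ℕ`, an infinite set on which `P N` and `P 0`
  -- agree.
  have hPeq : ∀ N, P N = P 0 := by
    intro N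
    refine Polynomial.eq_of_infinite_eval_eq _ _ (Set.Infinite.mono
      (s := Set.range fun n : ℕ => y + n) ?_ (Set.infinite_range_of_injective ?_))
    · rintro _ ⟨n, rfl⟩
      have h1 := hP N (n * (N + 1))
      have h0 := hP 0 n
      have : (N : ℝ) + 1 ≠ 0 := by positivity
      push_cast at h1 h0
      rw [mul_assoc, mul_inv_cancel₀ this, mul_one] at h1
      simp only [zero_add, inv_one, mul_one] at h0
      exact h1.symm.trans h0
    · intro a b hab
      simpa using hab
  refine ⟨P 0, fun x hx => ?_⟩
  have hlim : Tendsto (fun N : ℕ => y + (⌊(x - y) * ((N : ℝ) + 1)⌋₊ : ℝ) * ((N : ℝ) + 1)⁻¹)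
      atTop (𝓝 x) := by
    have h1 : Tendsto (fun N : ℕ => (N : ℝ) + 1) atTop atTop :=
      tendsto_atTop_add_const_right _ _ tendsto_natCast_atTop_atTop
    have h2 := ((tendsto_nat_floor_mul_div_atTop (sub_nonneg.2 hx)).comp h1).const_add y
    simpa [Function.comp_def, div_eq_mul_inv] using h2
  refine tendsto_nhds_unique ((hf.tendsto x).comp hlim)
    ((((P 0).continuous.tendsto x).comp hlim).congr fun N => ?_)
  simp only [Function.comp_apply]
  rw [hP N, hPeq N]

/-- A continuous function all of whose `m`-th forward differences vanish is a polynomial. -/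
theorem exists_polynomial_of_fwdDiff_iter_eq_zero {f : ℝ → ℝ} (hf : Continuous f) {m : ℕ}
    (hΔ : ∀ h x, (fwdDiff h)^[m] f x = 0) : ∃ p : Polynomial ℝ, ∀ x, f x = p.eval x := by
  choose P hP using exists_polynomial_of_fwdDiff_iter_eq_zero_of_le hf hΔ
  have hPeq : ∀ y, P y = P 0 := fun y =>
    Polynomial.eq_of_infinite_eval_eq _ _ <| (Set.Ici_infinite (max y 0)).mono fun x hx =>
      (hP y x ((le_max_left _ _).trans hx)).symm.trans (hP 0 x ((le_max_right _ _).trans hx))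
  exact ⟨P 0, fun x => by rw [hP x x le_rfl, hPeq]⟩

/-- If a ridge function `τ` in the direction of `p i₀` is cancelled by ridge functions in other
directions, then its iterated forward differences vanish. -/
theorem fwdDiff_iter_eq_zero_of_sum_ridge_eq_zero {ι κ : Type*} [Fintype ι] [DecidableEq κ]
    {p : κ → ι → ℝ} (hp : Function.Injective p) (i₀ : κ) (h : ℝ) (s : Finset κ) (hs : i₀ ∉ s)
    (τ : ℝ → ℝ) (g : κ → ℝ → ℝ)
    (H : ∀ (w : ι → ℝ) (b : ℝ), τ (w ⬝ᵥ p i₀ + b) + ∑ i ∈ s, g i (w ⬝ᵥ p i + b) = 0) (x : ℝ) :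
    (fwdDiff h)^[s.card] τ x = 0 := by
  induction s using Finset.induction_on generalizing τ g with
  | empty => simpa using H 0 x
  | insert i₁ s hi₁ ih =>
    rw [Finset.card_insert_of_notMem hi₁, Function.iterate_succ_apply]
    rw [Finset.mem_insert, not_or] at hs
    -- Shifting `w` by `μ` and `b` by `-μ ⬝ᵥ p i₁` fixes the argument of `g i₁` and moves that of
    -- `τ` by `h`. Subtracting the two relations removes `i₁` and differences `τ`.
    obtain ⟨μ, hμ⟩ : ∃ μ : ι → ℝ, μ ⬝ᵥ (p i₀ - p i₁) = h := by
      classical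
      obtain ⟨a, ha⟩ := Function.ne_iff.1 (hp.ne hs.1)
      refine ⟨Pi.single a (h / (p i₀ a - p i₁ a)), ?_⟩
      have := sub_ne_zero.2 ha
      simp only [single_dotProduct, Pi.sub_apply]
      field_simp
    refine ih hs.2 _ (fun i y => g i (y + μ ⬝ᵥ (p i - p i₁)) - g i y) fun w b => ?_
    have h1 := H (w + μ) (b - μ ⬝ᵥ p i₁)
    have h2 := H w b
    have e : ∀ i, (w + μ) ⬝ᵥ p i + (b - μ ⬝ᵥ p i₁) = w ⬝ᵥ p i + b + μ ⬝ᵥ (p i - p i₁) := by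
      intro i
      rw [add_dotProduct, dotProduct_sub]
      ring
    simp only [e, hμ, Finset.sum_insert hi₁, sub_self, dotProduct_zero, add_zero] at h1 h2
    simp only [fwdDiff, Finset.sum_sub_distrib]
    linarith

/-- The ridge functions of a continuous non-polynomial function span all functions on a finite
set of points. -/
theorem span_range_ridge_eq_top {σ : ℝ → ℝ} (hσ : Continuous σ)
    (hpoly : ¬ ∃ p : Polynomial ℝ, ∀ x : ℝ, σ x = p.eval x)
    {ι κ : Type*} [Fintype ι] [Finite κ] {p : κ → ι → ℝ} (hp : Function.Injective p) :
    Submodule.span ℝ (Set.range fun (a : (ι → ℝ) × ℝ) (i : κ) => σ (a.1 ⬝ᵥ p i + a.2)) = ⊤ := by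
  classical
  have := Fintype.ofFinite κ
  by_contra hne
  obtain ⟨φ, hφ, hker⟩ := Submodule.exists_le_ker_of_lt_top _ (lt_top_iff_ne_top.2 hne)
  have hsum : ∀ v : κ → ℝ, φ v = ∑ i, v i * φ (Pi.single i 1) := fun v => by
    rw [LinearMap.pi_apply_eq_sum_univ φ v]
    refine Finset.sum_congr rfl fun i _ => ?_
    rw [smul_eq_mul]
    congr 2
    ext j
    simp [Pi.single_apply, eq_comm]
  obtain ⟨i₀, hi₀⟩ : ∃ i, φ (Pi.single i 1) ≠ 0 := by
    by_contra! hall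
    exact hφ (LinearMap.ext fun v => by simp [hsum v, hall])
  refine hpoly (exists_polynomial_of_fwdDiff_iter_eq_zero hσ
    (m := (Finset.univ.erase i₀).card) fun h x => ?_)
  refine fwdDiff_iter_eq_zero_of_sum_ridge_eq_zero hp i₀ h _ (Finset.notMem_erase _ _) σ
    (fun i y => σ y * φ (Pi.single i 1) / φ (Pi.single i₀ 1)) (fun w b => ?_) x
  have h0 : φ (fun i => σ (w ⬝ᵥ p i + b)) = 0 :=
    hker (Submodule.subset_span ⟨(w, b), rfl⟩)
  rw [hsum, ← Finset.add_sum_erase _ _ (Finset.mem_univ i₀)] at h0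
  rw [← Finset.sum_div]
  field_simp
  linarith

/-- Perceptrons with one hidden layer and a continuous non-polynomial activation function
interpolate arbitrary data on finitely many points. -/
theorem exists_isMLP_interpolate {σ : ℝ → ℝ} (hσ : Continuous σ)
    (hpoly : ¬ ∃ p : Polynomial ℝ, ∀ x : ℝ, σ x = p.eval x)
    {ι : Type} [Fintype ι] {S : Set (ι → ℝ)} (hS : S.Finite) {m : ℕ}
    (g : (ι → ℝ) → Fin m → ℝ) : ∃ f : (ι → ℝ) → Fin m → ℝ, IsMLP σ f ∧ ∀ x ∈ S, f x = g x := by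
  classical
  have := hS.to_subtype
  have hspan := span_range_ridge_eq_top hσ hpoly (Subtype.val_injective (p := (· ∈ S)))
  have hc : ∀ j : Fin m, ∃ c : ((ι → ℝ) × ℝ) →₀ ℝ,
      (c.sum fun a r => r • fun i : S => σ (a.1 ⬝ᵥ i.1 + a.2)) = fun i : S => g i.1 j := fun j =>
    Finsupp.mem_span_range_iff_exists_finsupp.1 (hspan ▸ Submodule.mem_top)
  choose c hc using hc
  -- One hidden layer shared by all output coordinates.
  let T : Finset ((ι → ℝ) × ℝ) := Finset.univ.biUnion fun j => (c j).support
  let e := T.equivFin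
  refine ⟨_, IsMLP.oneHidden (Matrix.of fun q => (e.symm q).1.1) (fun q => (e.symm q).1.2)
    (Matrix.of fun j q => c j (e.symm q).1) 0, fun x hx => funext fun j => ?_⟩
  have h1 := congrFun (hc j) ⟨x, hx⟩
  rw [Finsupp.sum_of_support_subset (c j) (s := T)
    (Finset.subset_biUnion_of_mem (fun j => (c j).support) (Finset.mem_univ j)) _ (by simp)] at h1
  simp only [Finset.sum_apply, Pi.smul_apply, smul_eq_mul] at h1
  rw [← h1, ← Finset.sum_coe_sort T, ← e.symm.sum_comp]
  simp [Matrix.mulVec, dotProduct]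

/-! ### Folklore and oblivious Weisfeiler-Leman equivalence -/

/-- Two functions on a finite type whose fibres have equal cardinalities agree up to a
permutation. -/
theorem exists_perm_of_card_fiber_eq {α β : Type*} [Fintype α] [DecidableEq β] {f g : α → β}
    (h : ∀ b, (Finset.univ.filter fun a => f a = b).card =
      (Finset.univ.filter fun a => g a = b).card) :
    ∃ e : Equiv.Perm α, ∀ a, f a = g (e a) := by
  have hE : ∀ b, Nonempty ({a // f a = b} ≃ {a // g a = b}) := fun b =>
    Fintype.card_eq.1 (by simpa [Fintype.card_subtype] using h b)
  let E b := (hE b).some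
  refine ⟨(Equiv.sigmaFiberEquiv f).symm.trans
    ((Equiv.sigmaCongrRight E).trans (Equiv.sigmaFiberEquiv g)), fun a => ?_⟩
  exact (E (f a) ⟨a, rfl⟩).2.symm

theorem map_univ_val_eq_map_iff {α β : Type*} [Fintype α] {f g : α → β} :
    (Finset.univ : Finset α).val.map f = Finset.univ.val.map g ↔
      ∃ e : Equiv.Perm α, ∀ a, f a = g (e a) := by
  classical
  constructor
  · intro h
    refine exists_perm_of_card_fiber_eq fun b => ?_
    have := congrArg (Multiset.count b) h
    simpa [Multiset.count_map, Finset.card, Finset.filter, eq_comm] using this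
  · rintro ⟨e, he⟩
    rw [show f = g ∘ e from funext he, ← Multiset.map_map, Multiset.map_univ_val_equiv]

/-- Two tuples in labelled graphs have the same quantifier-free type. -/
def SameType {n ℓ : ℕ} {ι : Type*} (G H : LGraph n ℓ) (v w : ι → Fin n) : Prop :=
  (∀ i j, (v i = v j ↔ w i = w j) ∧ (G.graph.Adj (v i) (v j) ↔ H.graph.Adj (w i) (w j))) ∧
    ∀ i, G.col (v i) = H.col (w i)

theorem SameType.comp {n ℓ : ℕ} {ι κ : Type*} {G H : LGraph n ℓ} {v w : ι → Fin n}
    (h : SameType G H v w) (f : κ → ι) : SameType G H (v ∘ f) (w ∘ f) :=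
  ⟨fun i j => h.1 (f i) (f j), fun i => h.2 (f i)⟩

theorem SameType.of_comp_surjective {n ℓ : ℕ} {ι κ : Type*} {G H : LGraph n ℓ}
    {v w : ι → Fin n} {f : κ → ι} (hf : f.Surjective) (h : SameType G H (v ∘ f) (w ∘ f)) :
    SameType G H v w := by
  refine ⟨fun i j => ?_, fun i => ?_⟩
  · obtain ⟨i, rfl⟩ := hf i
    obtain ⟨j, rfl⟩ := hf j
    exact h.1 i j
  · obtain ⟨i, rfl⟩ := hf i
    exact h.2 i

theorem atp_eq_iff {n ℓ k : ℕ} {G H : LGraph n ℓ} {v w : Fin k → Fin n} :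
    atp G v = atp H w ↔ SameType G H v w := by
  classical
  constructor
  · intro h
    have heq : ∀ i j, i < j → (v i = v j ↔ w i = w j) := fun i j hij => by
      have := congrFun h (Sum.inl ⟨(i, j), hij⟩)
      simp only [atp] at this
      by_cases h1 : v i = v j <;> by_cases h2 : w i = w j <;> simp_all
    have hadj : ∀ i j, i < j → (G.graph.Adj (v i) (v j) ↔ H.graph.Adj (w i) (w j)) :=
      fun i j hij => by
        have := congrFun h (Sum.inr (Sum.inl ⟨(i, j), hij⟩))
        simp only [atp] at this
        by_cases h1 : G.graph.Adj (v i) (v j) <;> by_cases h2 : H.graph.Adj (w i) (w j) <;>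
          simp_all
    refine ⟨fun i j => ?_, fun i => funext fun q => congrFun h (Sum.inr (Sum.inr (i, q)))⟩
    rcases lt_trichotomy i j with hij | rfl | hij
    · exact ⟨heq i j hij, hadj i j hij⟩
    · simp
    · rw [eq_comm, G.graph.adj_comm, eq_comm (a := w i), H.graph.adj_comm]
      exact ⟨heq j i hij, hadj j i hij⟩
  · rintro ⟨h, hcol⟩
    funext a
    rcases a with ⟨p, hp⟩ | ⟨p, hp⟩ | q
    · simp only [atp, (h p.1 p.2).1]
    · simp only [atp, (h p.1 p.2).2]
    · exact congrFun (hcol q.1) q.2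

/-- Folklore refinement needs a single matching `e` for all positions; the oblivious one allows a
different matching per position. -/
theorem wl_succ_eq_iff {n ℓ k t : ℕ} {G H : LGraph n ℓ} {v w : Fin k → Fin n} :
    wl (t + 1) G v = wl (t + 1) H w ↔ wl t G v = wl t H w ∧ ∃ e : Equiv.Perm (Fin n), ∀ u,
      SameType G H (Fin.snoc v u : Fin (k + 1) → Fin n) (Fin.snoc w (e u) : Fin (k + 1) → Fin n) ∧
        ∀ i, wl t G (Function.update v i u) = wl t H (Function.update w i (e u)) := by
  refine Prod.mk_inj.trans (and_congr_right' ?_)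
  rw [map_univ_val_eq_map_iff]
  exact exists_congr fun e => forall_congr' fun u =>
    Prod.mk_inj.trans (and_congr atp_eq_iff funext_iff)

theorem SameType.of_wl_eq {n ℓ k t : ℕ} {G H : LGraph n ℓ} {v w : Fin k → Fin n}
    (h : wl t G v = wl t H w) : SameType G H v w := by
  induction t with
  | zero => exact atp_eq_iff.1 h
  | succ t ih => exact ih (wl_succ_eq_iff.1 h).1

theorem snoc_comp_snoc {k m n : ℕ} (x : Fin m → Fin n) (f : Fin k → Fin m) (i : Fin m) :
    x ∘ (Fin.snoc f i : Fin (k + 1) → Fin m) = (Fin.snoc (x ∘ f) (x i) : Fin (k + 1) → Fin n) :=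
  Fin.comp_snoc x f i

/-- Equality of Weisfeiler-Leman labels is invariant under permuting the entries of tuples. -/
theorem wl_comp_perm_eq {n ℓ k t : ℕ} {G H : LGraph n ℓ} {v w : Fin k → Fin n}
    (h : wl t G v = wl t H w) (π : Equiv.Perm (Fin k)) :
    wl t G (v ∘ π) = wl t H (w ∘ π) := by
  induction t generalizing v w with
  | zero => exact atp_eq_iff.2 ((atp_eq_iff.1 h).comp π)
  | succ t ih =>
    obtain ⟨h0, e, he⟩ := wl_succ_eq_iff.1 h
    refine wl_succ_eq_iff.2 ⟨ih h0, e, fun u => ⟨?_, fun i => ?_⟩⟩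
    · have := (he u).1.comp (Fin.snoc (Fin.castSucc ∘ π) (Fin.last k) : Fin (k + 1) → Fin (k + 1))
      rw [snoc_comp_snoc, snoc_comp_snoc, ← Function.comp_assoc, ← Function.comp_assoc] at this
      simpa [Fin.snoc_comp_castSucc] using this
    · have := ih ((he u).2 (π i))
      rwa [Function.update_comp_eq_of_injective _ π.injective,
        Function.update_comp_eq_of_injective _ π.injective] at this

/-- Tuples of the same type after `t` rounds of the oblivious Weisfeiler-Leman algorithm, which
refines a tuple by the multisets of labels of its one-entry modifications, one for each entry. -/
def ObliviousEquiv {n ℓ k : ℕ} : ℕ → (G H : LGraph n ℓ) → (Fin k → Fin n) → (Fin k → Fin n) → Prop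
  | 0, G, H, x, y => SameType G H x y
  | t + 1, G, H, x, y => ObliviousEquiv t G H x y ∧ ∀ i, ∃ e : Equiv.Perm (Fin n), ∀ u,
      ObliviousEquiv t G H (Function.update x i u) (Function.update y i (e u))

theorem exists_perm_of_injective {α β : Type*} [Finite α] {f g : α → β} (hg : g.Injective)
    (h : ∀ a, ∃ b, f b = g a) : ∃ π : Equiv.Perm α, g = f ∘ π := by
  choose π hπ using h
  have hinj : π.Injective := fun a b hab => hg (by rw [← hπ a, ← hπ b, hab])
  exact ⟨Equiv.ofBijective π (Finite.injective_iff_bijective.1 hinj), funext fun a => (hπ a).symm⟩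

theorem exists_forall_ne_of_injective {r : ℕ} (f : Fin r → Fin (r + 1)) : ∃ i, ∀ j, f j ≠ i := by
  by_contra! h
  have := Fintype.card_le_of_surjective f h
  simp at this

theorem snoc_surjective_of_injective {r : ℕ} {f : Fin r → Fin (r + 1)} (hf : f.Injective)
    {i : Fin (r + 1)} (hi : ∀ j, f j ≠ i) :
    (Fin.snoc f i : Fin (r + 1) → Fin (r + 1)).Surjective := by
  refine Finite.injective_iff_surjective.1 (Fin.snoc_injective_of_injective hf ?_)
  rintro ⟨j, hj⟩
  exact hi j hj

/-- Oblivious `(r + 1)`-WL on a tuple amounts to folklore `r`-WL on its `r`-element subtuples,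
round by round. -/
theorem obliviousEquiv_iff {n ℓ r t : ℕ} {G H : LGraph n ℓ} {x y : Fin (r + 1) → Fin n} :
    ObliviousEquiv t G H x y ↔ SameType G H x y ∧
      ∀ f : Fin r → Fin (r + 1), f.Injective → wl t G (x ∘ f) = wl t H (y ∘ f) := by
  induction t generalizing x y with
  | zero => exact ⟨fun h => ⟨h, fun f _ => atp_eq_iff.2 (h.comp f)⟩, fun h => h.1⟩
  | succ t ih =>
    constructor
    · rintro ⟨h0, h1⟩
      rw [ih] at h0
      refine ⟨h0.1, fun f hf => wl_succ_eq_iff.2 ⟨h0.2 f hf, ?_⟩⟩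
      obtain ⟨i, hi⟩ := exists_forall_ne_of_injective f
      obtain ⟨e, he⟩ := h1 i
      refine ⟨e, fun u => ?_⟩
      have hu := ih.1 (he u)
      constructor
      · have := hu.1.comp (Fin.snoc f i : Fin (r + 1) → Fin (r + 1))
        rwa [snoc_comp_snoc, snoc_comp_snoc, Function.update_comp_eq_of_forall_ne _ _ hi,
          Function.update_comp_eq_of_forall_ne _ _ hi, Function.update_self,
          Function.update_self] at this
      · intro j
        have hcomp : ∀ (z : Fin (r + 1) → Fin n) (u : Fin n),
            Function.update z i u ∘ Function.update f j i = Function.update (z ∘ f) j u := by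
          intro z u
          rw [Function.comp_update, Function.update_self,
            Function.update_comp_eq_of_forall_ne _ _ hi]
        rw [← hcomp, ← hcomp]
        refine hu.2 _ fun a b hab => ?_
        rw [Function.update_apply, Function.update_apply] at hab
        split_ifs at hab with ha hb hb
        · exact ha.trans hb.symm
        · exact absurd hab.symm (hi b)
        · exact absurd hab (hi a)
        · exact hf hab
    · rintro ⟨hxy, hwl⟩
      have hwl' : ∀ f : Fin r → Fin (r + 1), f.Injective → wl t G (x ∘ f) = wl t H (y ∘ f) :=
        fun f hf => (wl_succ_eq_iff.1 (hwl f hf)).1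
      refine ⟨ih.2 ⟨hxy, hwl'⟩, fun i => ?_⟩
      have hi : ∀ j, i.succAbove j ≠ i := i.succAbove_ne
      obtain ⟨e, he⟩ := (wl_succ_eq_iff.1 (hwl _ (Fin.succAbove_right_injective (p := i)))).2
      refine ⟨e, fun u => ih.2 ⟨?_, fun g hg => ?_⟩⟩
      · refine SameType.of_comp_surjective
          (snoc_surjective_of_injective Fin.succAbove_right_injective hi) ?_
        rw [snoc_comp_snoc, snoc_comp_snoc, Function.update_comp_eq_of_forall_ne _ _ hi,
          Function.update_comp_eq_of_forall_ne _ _ hi, Function.update_self, Function.update_self]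
        exact (he u).1
      -- A subtuple avoiding `i` is unchanged. Otherwise `g` misses some `i₀ ≠ i`, and up to order
      -- it is `i.succAbove` with the slot of `i₀` redirected to `i`.
      · by_cases hgi : ∀ a, g a ≠ i
        · rw [Function.update_comp_eq_of_forall_ne _ _ hgi,
            Function.update_comp_eq_of_forall_ne _ _ hgi]
          exact hwl' g hg
        · push Not at hgi
          obtain ⟨a₀, ha₀⟩ := hgi
          obtain ⟨i₀, hi₀⟩ := exists_forall_ne_of_injective g
          obtain ⟨j, hj⟩ := Fin.exists_succAbove_eq (x := i₀) (y := i) (by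
            rintro rfl
            exact hi₀ a₀ ha₀)
          obtain ⟨π, hπ⟩ := exists_perm_of_injective (f := Function.update i.succAbove j i) hg
            fun a => by
              rcases eq_or_ne (g a) i with h | h
              · exact ⟨j, by simp [h]⟩
              · obtain ⟨b, hb⟩ := Fin.exists_succAbove_eq h
                refine ⟨b, ?_⟩
                rw [Function.update_of_ne, hb]
                rintro rfl
                exact hi₀ a (hb.symm.trans hj)
          have hcomp : ∀ (z : Fin (r + 1) → Fin n) (u : Fin n),
              Function.update z i u ∘ g = Function.update (z ∘ i.succAbove) j u ∘ π := by
            intro z u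
            rw [hπ, ← Function.comp_assoc, Function.comp_update, Function.update_self,
              Function.update_comp_eq_of_forall_ne _ _ hi]
          rw [hcomp, hcomp]
          exact wl_comp_perm_eq ((he u).2 j) π

/-- All `r`-subtuples of a constant tuple coincide, and since `r ≥ 1` their label already determines
the type of the whole tuple. -/
theorem obliviousEquiv_const_iff {n ℓ r t : ℕ} (hr : 1 ≤ r) {G H : LGraph n ℓ} {v w : Fin n} :
    ObliviousEquiv t G H (fun _ : Fin (r + 1) => v) (fun _ => w) ↔
      wl t G (fun _ : Fin r => v) = wl t H (fun _ => w) := by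
  rw [obliviousEquiv_iff]
  constructor
  · exact fun h => h.2 Fin.castSucc (Fin.castSucc_injective r)
  · exact fun h => ⟨(SameType.of_wl_eq h).comp fun _ : Fin (r + 1) => (⟨0, hr⟩ : Fin r),
      fun _ _ => h⟩

/-! ### Separation power of `k`-GINs -/

theorem IsGINTensor.eq_of_obliviousEquiv {σ : ℝ → ℝ} {n ℓ k t : ℕ} {ι : Type}
    {F : LGraph n ℓ → (Fin k → Fin n) → ι → ℝ} (hF : IsGINTensor σ t F)
    {G H : LGraph n ℓ} {x y : Fin k → Fin n} (h : ObliviousEquiv t G H x y) : F G x = F H y := by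
  induction hF generalizing x y with
  | init => exact atp_eq_iff.2 h
  | layer _ _ _ ih =>
    simp only [ginLayer]
    congr 2
    · exact ih h.1
    · funext p
      obtain ⟨e, he⟩ := h.2 p.1
      exact Fintype.sum_equiv e _ _ fun u => by rw [ih (he u)]

/-- On finitely many graphs, some `k`-GIN is at least as separating as the oblivious `k`-WL
algorithm with the same number of rounds. -/
theorem exists_isGINTensor_obliviousEquiv {σ : ℝ → ℝ} (hσ : Continuous σ)
    (hpoly : ¬ ∃ p : Polynomial ℝ, ∀ x : ℝ, σ x = p.eval x) {n ℓ : ℕ} (k t : ℕ)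
    {𝓖 : Set (LGraph n ℓ)} (h𝓖 : 𝓖.Finite) :
    ∃ (ι : Type) (_ : Fintype ι) (F : LGraph n ℓ → (Fin k → Fin n) → ι → ℝ), IsGINTensor σ t F ∧
      ∀ G ∈ 𝓖, ∀ H ∈ 𝓖, ∀ x y, F G x = F H y → ObliviousEquiv t G H x y := by
  classical
  induction t with
  | zero => exact ⟨_, inferInstance, _, .init, fun G _ H _ x y => atp_eq_iff.1⟩
  | succ t ih =>
    obtain ⟨ι, _, F, hF, hsep⟩ := ih
    have hfin : ∀ {α : Type} (f : LGraph n ℓ → (Fin k → Fin n) → α),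
        (Set.image2 f 𝓖 Set.univ).Finite := fun f => h𝓖.image2 f Set.finite_univ
    obtain ⟨S, hS⟩ := (hfin F).exists_finset_coe
    have hmem : ∀ G ∈ 𝓖, ∀ x, F G x ∈ S := fun G hG x => by
      rw [← Finset.mem_coe, hS]
      exact ⟨G, hG, x, trivial, rfl⟩
    let e := S.equivFin
    -- One-hot encoding of the occurring features, so that sums over `u` become multiplicities.
    obtain ⟨mlp₁, h₁, hmlp₁⟩ := exists_isMLP_interpolate hσ hpoly S.finite_toSet
      (m := S.card) fun z q => if z = (e.symm q).1 then 1 else 0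
    have hsum : ∀ G ∈ 𝓖, ∀ x i (s : S), ∑ u, mlp₁ (F G (Function.update x i u)) (e s) =
        ((Finset.univ.filter fun u => F G (Function.update x i u) = s.1).card : ℝ) := by
      intro G hG x i s
      rw [Finset.card_filter, Nat.cast_sum]
      refine Finset.sum_congr rfl fun u _ => ?_
      rw [hmlp₁ _ (hmem G hG _)]
      simp
    let I : LGraph n ℓ → (Fin k → Fin n) → ι ⊕ (Fin k × Fin S.card) → ℝ := fun G x =>
      Sum.elim (F G x) fun p => ∑ u : Fin n, mlp₁ (F G (Function.update x p.1 u)) p.2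
    obtain ⟨T, hT⟩ := (hfin I).exists_finset_coe
    -- An injective numbering of the occurring inputs suffices; the default `0` is never met on `𝓖`.
    obtain ⟨mlp₀, h₀, hmlp₀⟩ := exists_isMLP_interpolate hσ hpoly T.finite_toSet
      (m := 1) fun z _ => if hz : z ∈ T then ((T.equivFin ⟨z, hz⟩ : ℕ) : ℝ) else 0
    have hmemT : ∀ G ∈ 𝓖, ∀ x, I G x ∈ T := fun G hG x => by
      rw [← Finset.mem_coe, hT]
      exact ⟨G, hG, x, trivial, rfl⟩
    refine ⟨_, inferInstance, _, hF.layer h₁ h₀, fun G hG H hH x y hxy => ?_⟩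
    have hI : I G x = I H y := by
      have h := congrFun hxy 0
      change mlp₀ (I G x) 0 = mlp₀ (I H y) 0 at h
      rw [hmlp₀ _ (hmemT G hG x), hmlp₀ _ (hmemT H hH y), dif_pos (hmemT G hG x),
        dif_pos (hmemT H hH y), Nat.cast_inj, Fin.val_inj, T.equivFin.apply_eq_iff_eq] at h
      exact Subtype.ext_iff.1 h
    have hFxy : F G x = F H y := funext fun a => congrFun hI (Sum.inl a)
    refine ⟨hsep G hG H hH x y hFxy, fun i => ?_⟩
    obtain ⟨π, hπ⟩ := exists_perm_of_card_fiber_eq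
      (f := fun u => F G (Function.update x i u)) (g := fun u => F H (Function.update y i u))
      fun b => by
        by_cases hb : b ∈ S
        · have h := congrFun hI (Sum.inr (i, e ⟨b, hb⟩))
          simp only [I, Sum.elim_inr] at h
          rw [hsum G hG, hsum H hH, Nat.cast_inj] at h
          exact h
        · rw [Finset.filter_false_of_mem, Finset.filter_false_of_mem]
          · rintro u - rfl
            exact hb (hmem H hH _)
          · rintro u - rfl
            exact hb (hmem G hG _)
    exact ⟨π, fun u => hsep G hG H hH _ _ (hπ u)⟩

theorem mainTheorem10 (σ : ℝ → ℝ) (hσ : Continuous σ)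
    (hσ_poly : ¬ ∃ p : Polynomial ℝ, ∀ x : ℝ, σ x = p.eval x)
    (n ℓ k t : ℕ) (hk : 2 ≤ k) :
    rhoOne (kGIN σ n ℓ k t) = rhoOne {⟨WLLabel (k - 1) ℓ t, vwl (k - 1) t⟩} := by
  obtain ⟨r, rfl⟩ : ∃ r, k = r + 1 := ⟨k - 1, by omega⟩
  have hr : 1 ≤ r := by omega
  rw [Nat.add_sub_cancel]
  ext ⟨G, v⟩ ⟨H, w⟩
  constructor
  · intro h f hf
    rw [Set.mem_singleton_iff] at hf
    subst hf
    -- The GIN may depend on the pair being separated, so two graphs suffice even though real labels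
    -- give infinitely many.
    obtain ⟨ι, _, F, hF, hsep⟩ := exists_isGINTensor_obliviousEquiv hσ hσ_poly (r + 1) t
      (Set.toFinite {G, H})
    refine (obliviousEquiv_const_iff hr).1 (hsep G (by simp) H (by simp) _ _ ?_)
    exact h _ ⟨ι, F, hF, rfl⟩
  · rintro h f ⟨ι, F, hF, rfl⟩
    exact hF.eq_of_obliviousEquiv ((obliviousEquiv_const_iff hr).2 (h _ rfl))
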